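/- **Theorem.** Consider a network of $n$ nodes: a connected simple undirected graph $G$ (the footprint) with anonymous nodes, in which the edges at every node $v$ carry distinct local port numbers $0,\dots,\delta_v-1$ ($\delta_v$ is the degree of $v$). One node, $v_{BH}$, of degree $\delta_{BH}$, is a black hole: it destroys every agent that enters it. In each synchronous round an adversary may remove at most one edge of $G$, provided that the graph of that round stays connected. Finitely many agents start at arbitrary nodes other than $v_{BH}$, with distinct identifiers in $[1,n^c]$, where $c>1$ is a constant. All agents run the same deterministic algorithm, which does not depend on $n$, on $G$ or on the number of agents; initially all memories and all whiteboards (one at each node) are blank. In each round every agent that is neither destroyed nor terminated sees the degree of its node in $G$, the whiteboard of its node, the identifiers and memories of all agents at its node, and whether its last attempt to move succeeded (and then its port of entry) or failed because the edge was removed; it then updates its memory, may write on the whiteboard, and stays, tries to move through a port, or terminates. The black hole search problem $1$-BHS is solved in an execution if some agent survives and terminates designating (by a port sequence from its node) an edge incident to $v_{BH}$. For every $c>1$ and every algorithm that, on networks with $n$ nodes and exactly $2\delta_{BH}$ agents, uses $O(\log n)$ bits of memory per agent and $O(\log n)$ bits of whiteboard storage per node, the following holds. For all sufficiently large $n$ there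 are a port-labelled footprint with $n$ nodes, a black hole, an initial configuration of $2\delta_{BH}$ agents (positions and identifiers) and a behaviour of the adversary, such that the algorithm does not solve $1$-BHS. In particular, no such algorithm solves $1$-BHS with $2\delta_{BH}$ agents from arbitrary initial configurations. -/

import Mathlib

namespace BlackHole

open scoped Classical in
section

/-- What an agent is told about its own move of the previous round: it did not attempt a move, its
attempt failed because the edge was missing, or it succeeded and entered the present node
through the local port `p`. -/
inductive Feedback where
  | stayed
  | blocked
  | arrived (p : ℕ)

/-- The parameters of an agent which can be read by all agents located at the same node: its
identifier, its memory (a bit string), the outcome of its last move, and whether it has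
terminated. -/
structure AgentInfo where
  id : ℕ
  mem : List Bool
  feedback : Feedback
  halted : Bool

/-- Everything an agent perceives in its Look phase: the degree of its node in the footprint, the
content of the whiteboard there, its own parameters, and the set of the parameters of all agents
located at this node (itself included). -/
structure Look where
  degree : ℕ
  board : List Bool
  self : AgentInfo
  here : Set AgentInfo

/-- What an agent does at the end of its Compute phase: stay, try to move through a local port, or
terminate. A terminating agent designates an edge, by giving a sequence `w` of ports to be
followed in the footprint from its present node, and a port `p` of the node so reached. -/
inductive Action where
  | stay
  | move (p : ℕ)
  | terminate (w : List ℕ) (p : ℕ)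

/-- The outcome of a Compute phase: the new memory, the new content of the whiteboard (if the agent
wants to write) and the action. -/
structure Decision where
  mem : List Bool
  write : Option (List Bool)
  action : Action

/-- A deterministic algorithm, the same for all agents, all networks and all network sizes. -/
abbrev Algorithm := Look → Decision

/-- A network with `n` nodes whose edges are controlled by an adversary that removes at most `f`
edges per round, together with a black hole and an initial configuration of agents with
identifiers in `[1, n ^ c]`.  As algorithms are deterministic, an adversary is the same as the
sequence of the graphs present in the successive rounds. -/
structure Instance (n f : ℕ) (c : ℝ) where
  /-- the footprint -/
  G : SimpleGraph (Fin n)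
  /-- the local port numbering at every node, by `0, …, deg v - 1` -/
  port : ∀ v : Fin n, Fin (Nat.card (G.neighborSet v)) ≃ G.neighborSet v
  /-- the graph of the edges available in each round -/
  snapshot : ℕ → SimpleGraph (Fin n)
  snapshot_le : ∀ t, snapshot t ≤ G
  snapshot_connected : ∀ t, (snapshot t).Connected
  removed_le : ∀ t, (G.edgeSet \ (snapshot t).edgeSet).ncard ≤ f
  /-- the black hole -/
  bh : Fin n
  /-- the number of agents -/
  k : ℕ
  /-- the identifiers of the agents; the agents are listed by increasing identifier -/
  id : Fin k → ℕ
  id_strictMono : StrictMono id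
  one_le_id : ∀ i, 1 ≤ id i
  id_le : ∀ i, (id i : ℝ) ≤ (n : ℝ) ^ c
  /-- the initial positions, arbitrary safe nodes -/
  start : Fin k → Fin n
  start_safe : ∀ i, start i ≠ bh

/-- A global configuration of `k` agents on `n` nodes. `output i` is the edge designated by agent `i`
if it has terminated. -/
structure Config (n k : ℕ) where
  pos : Fin k → Fin n
  mem : Fin k → List Bool
  feedback : Fin k → Feedback
  output : Fin k → Option (List ℕ × ℕ)
  board : Fin n → List Bool

namespace Instance

variable {n f : ℕ} {c : ℝ} (I : Instance n f c)

/-- The degree of a node in the footprint. -/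
noncomputable def deg (v : Fin n) : ℕ := Nat.card (I.G.neighborSet v)

/-- The node at the other end of the edge with port `p` at `v`, if there is such a port. -/
noncomputable def nbr (v : Fin n) (p : ℕ) : Option (Fin n) :=
  if h : p < I.deg v then some (I.port v ⟨p, h⟩).1 else none

/-- The port number at `u` of the edge `u v` of the footprint. -/
noncomputable def portTo (u v : Fin n) (h : I.G.Adj u v) : ℕ := ((I.port u).symm ⟨v, h⟩).1

/-- The node reached from `v` by following a sequence of ports in the footprint. -/
noncomputable def follow : Fin n → List ℕ → Option (Fin n)
  | v, [] => some v
  | v, p :: w => (I.nbr v p).bind fun u => follow u w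

/-- Seen from the node `v`, the pair `(w, p)` designates an edge incident to the black hole. -/
def DesignatesBH (v : Fin n) (w : List ℕ) (p : ℕ) : Prop :=
  ∃ u u' : Fin n, I.follow v w = some u ∧ I.nbr u p = some u' ∧ (u = I.bh ∨ u' = I.bh)

/-- Initially all memories and all whiteboards are blank. -/
def init : Config n I.k where
  pos := I.start
  mem := fun _ => []
  feedback := fun _ => .stayed
  output := fun _ => none
  board := fun _ => []

/-- The readable parameters of agent `i`. -/
def info (s : Config n I.k) (i : Fin I.k) : AgentInfo where
  id := I.id i
  mem := s.mem i
  feedback := s.feedback i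
  halted := (s.output i).isSome

/-- The Look phase of agent `i`. -/
noncomputable def look (s : Config n I.k) (i : Fin I.k) : Look where
  degree := I.deg (s.pos i)
  board := s.board (s.pos i)
  self := I.info s i
  here := {a | ∃ j, s.pos j = s.pos i ∧ a = I.info s j}

/-- An agent acts as long as it has neither been destroyed by the black hole nor terminated. -/
def Active (s : Config n I.k) (i : Fin I.k) : Prop := s.pos i ≠ I.bh ∧ s.output i = none

/-- The Move phase in round `t` of an agent at `v`: its new position and its feedback. -/
noncomputable def moveResult (t : ℕ) (v : Fin n) : Action → Fin n × Feedback
  | .move p =>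
      if h : p < I.deg v then
        if (I.snapshot t).Adj v (I.port v ⟨p, h⟩).1 then
          ((I.port v ⟨p, h⟩).1, .arrived (I.portTo _ v (I.port v ⟨p, h⟩).2.symm))
        else (v, .blocked)
      else (v, .stayed)
  | _ => (v, .stayed)

/-- Round `t`: all active agents simultaneously perform one Look-Compute-Move cycle. If several agents
at a node want to write, the one with the smallest identifier does. (The algorithm loses nothing by
this rule, since each agent reads the parameters of all agents at its node and hence knows what the
others are about to do.) -/
noncomputable def step (A : Algorithm) (t : ℕ) (s : Config n I.k) : Config n I.k where
  pos := fun i =>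
    if I.Active s i then (I.moveResult t (s.pos i) (A (I.look s i)).action).1 else s.pos i
  mem := fun i => if I.Active s i then (A (I.look s i)).mem else s.mem i
  feedback := fun i =>
    if I.Active s i then (I.moveResult t (s.pos i) (A (I.look s i)).action).2 else s.feedback i
  output := fun i =>
    if I.Active s i then
      match (A (I.look s i)).action with
      | .terminate w p => some (w, p)
      | _ => none
    else s.output i
  board := fun v =>
    ((List.finRange I.k).findSome? fun i =>
      if I.Active s i ∧ s.pos i = v then (A (I.look s i)).write else none).getD (s.board v)

/-- The configuration at the beginning of round `t` of the execution of `A`. -/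
noncomputable def exec (A : Algorithm) : ℕ → Config n I.k
  | 0 => I.init
  | t + 1 => I.step A t (exec A t)

/-- The execution of `A` finds the black hole: some agent survives and terminates, in some round,
designating an edge incident to the black hole. -/
def FoundBy (A : Algorithm) : Prop :=
  ∃ (t : ℕ) (i : Fin I.k) (w : List ℕ) (p : ℕ),
    (I.exec A t).pos i ≠ I.bh ∧ (I.exec A t).output i = some (w, p) ∧
      I.DesignatesBH ((I.exec A t).pos i) w p

end Instance

/-- On all instances with `n` nodes and `2 δ` agents, where `δ` is the degree of the black hole, the
algorithm uses `O(log n)` bits of memory per agent and `O(log n)` bits of storage per node. -/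
def UsesLogSpace (A : Algorithm) (f : ℕ) (c : ℝ) : Prop :=
  ∃ C : ℕ, ∀ (n : ℕ) (I : Instance n f c), I.k = 2 * I.deg I.bh → ∀ t : ℕ,
    (∀ i, ((I.exec A t).mem i).length ≤ C * Nat.log 2 n) ∧
      ∀ v, ((I.exec A t).board v).length ≤ C * Nat.log 2 n

end

end BlackHole

/-! The black hole is taken to be a leaf, so only two agents are available, and they never meet. One
starts at node 0 of a 4-cycle. Both edges there lie on the cycle, so the adversary may always remove
the one this agent is about to use, and it stays there forever. The other agent starts at node 1 or
2, both of degree 3. Until an agent leaves its node, its run depends only on its identifier and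
degree: this is `solo`, and `ringInstance_exec` is the resulting invariant.

If the second agent's solo run ever attempts a move, let `q` be the first port used. Ports are
numbered so that `q` leads from 1 to leaf 3 and from 2 to leaf 4, and the black hole is put there.
The agent is destroyed without having terminated, and the agent at 0 cannot tell the two instances
apart. Its only possible designation is an edge, which cannot be incident to both of the nonadjacent
nodes 3 and 4, so it is wrong in one instance.

If the second agent never attempts a move, both agents have a fixed designation. Each is right for
at most one of the three leaves 3, 4, 6, so some leaf escapes both. -/

namespace BlackHole

/-! ### Runs of a lonely agent that never leaves its node -/

section Solo

/-- The state of an agent which never meets another agent and never leaves its node, together with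
the whiteboard of this node. -/
structure SoloState where
  mem : List Bool
  feedback : Feedback
  output : Option (List ℕ × ℕ)
  board : List Bool

/-- The readable parameters of an agent with identifier `id` in state `σ`. -/
def SoloState.info (σ : SoloState) (id : ℕ) : AgentInfo :=
  ⟨id, σ.mem, σ.feedback, σ.output.isSome⟩

/-- The perception of a lonely agent at a node of degree `d`. -/
def SoloState.look (σ : SoloState) (id d : ℕ) : Look :=
  ⟨d, σ.board, σ.info id, {σ.info id}⟩

/-- The existing port, if any, through which a lonely agent tries to leave its node. -/
def SoloState.attempt (A : Algorithm) (id d : ℕ) (σ : SoloState) : Option ℕ :=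
  if σ.output = none then
    match (A (σ.look id d)).action with
    | .move p => if p < d then some p else none
    | _ => none
  else none

/-- One round of a lonely agent all of whose moves are blocked. -/
def SoloState.step (A : Algorithm) (id d : ℕ) (σ : SoloState) : SoloState :=
  if σ.output = none then
    { mem := (A (σ.look id d)).mem
      feedback :=
        match (A (σ.look id d)).action with
        | .move p => if p < d then .blocked else .stayed
        | _ => .stayed
      output :=
        match (A (σ.look id d)).action with
        | .terminate w p => some (w, p)
        | _ => none
      board := (A (σ.look id d)).write.getD σ.board }
  else σ

/-- The execution of a lonely agent all of whose moves are blocked. -/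
def solo (A : Algorithm) (id d : ℕ) : ℕ → SoloState
  | 0 => ⟨[], .stayed, none, []⟩
  | t + 1 => (solo A id d t).step A id d

variable {A : Algorithm} {id d : ℕ}

theorem SoloState.lt_of_attempt {σ : SoloState} {p : ℕ} (h : σ.attempt A id d = some p) :
    p < d := by
  unfold SoloState.attempt at h
  split_ifs at h
  split at h
  · split_ifs at h with hp
    simp_all
  · simp at h

theorem solo_output_of_le {t t' : ℕ} {o : List ℕ × ℕ} (h : t ≤ t')
    (ho : (solo A id d t).output = some o) : (solo A id d t').output = some o := by
  induction t', h using Nat.le_induction with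
  | base => exact ho
  | succ t' _ ih => simp [solo, SoloState.step, ih]

theorem solo_output_unique {t t' : ℕ} {o o' : List ℕ × ℕ}
    (ho : (solo A id d t).output = some o) (ho' : (solo A id d t').output = some o') : o = o' := by
  rcases le_total t t' with h | h
  · exact Option.some.inj ((solo_output_of_le h ho).symm.trans ho')
  · exact Option.some.inj (ho.symm.trans (solo_output_of_le h ho'))

/-- There is one edge designation which is the only possible output of a lonely agent. -/
theorem exists_solo_output (A : Algorithm) (id d : ℕ) :
    ∃ o, ∀ t o', (solo A id d t).output = some o' → o' = o := by
  by_cases h : ∃ t o, (solo A id d t).output = some o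
  · obtain ⟨t, o, ho⟩ := h
    exact ⟨o, fun t' o' ho' => solo_output_unique ho' ho⟩
  · push Not at h
    -- The run never terminates here, so any default value will do.
    exact ⟨([], 0), fun t o' ho' => (h t o' ho').elim⟩

/-- Makes termination before the first attempted move impossible when such a move exists. -/
theorem solo_attempt_of_output {t t' : ℕ} {o : List ℕ × ℕ} (h : t ≤ t')
    (ho : (solo A id d t).output = some o) : (solo A id d t').attempt A id d = none := by
  simp [SoloState.attempt, solo_output_of_le h ho]

end Solo

theorem findSome?_eq_of_unique {α β : Type*} {f : α → Option β} {l : List α} {i : α}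
    (hi : i ∈ l) (h : ∀ j, j ≠ i → f j = none) : l.findSome? f = f i := by
  rcases hfi : f i with _ | b
  · rw [List.findSome?_eq_none_iff]
    intro j _
    by_cases hj : j = i
    · rw [hj, hfi]
    · exact h j hj
  · induction l with
    | nil => simp at hi
    | cons x l ih =>
      by_cases hx : x = i
      · simp [hx, hfi]
      · rw [List.findSome?_cons, h x hx]
        exact ih ((List.mem_cons.1 hi).resolve_left (Ne.symm hx))

/-! ### Comparing a real execution with the solo run -/

namespace Instance

variable {n f : ℕ} {c : ℝ} {I : Instance n f c} {A : Algorithm} {s : Config n I.k} {i : Fin I.k}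
  {σ : SoloState} {t : ℕ}

/-- In the configuration `s`, agent `i` is alone at a safe node, and `σ` is its state. -/
structure IsSolo (I : Instance n f c) (s : Config n I.k) (i : Fin I.k) (σ : SoloState) : Prop where
  safe : s.pos i ≠ I.bh
  alone : ∀ j, j ≠ i → s.pos j ≠ s.pos i
  mem : s.mem i = σ.mem
  feedback : s.feedback i = σ.feedback
  output : s.output i = σ.output
  board : s.board (s.pos i) = σ.board

theorem IsSolo.info_eq (h : I.IsSolo s i σ) : I.info s i = σ.info (I.id i) := by
  simp [Instance.info, SoloState.info, h.mem, h.feedback, h.output]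

theorem IsSolo.look_eq (h : I.IsSolo s i σ) :
    I.look s i = σ.look (I.id i) (I.deg (s.pos i)) := by
  have hset : {a | ∃ j, s.pos j = s.pos i ∧ a = I.info s j} = {I.info s i} := by
    ext a
    constructor
    · rintro ⟨j, hj, rfl⟩
      by_cases hji : j = i
      · rw [hji]; rfl
      · exact (h.alone j hji hj).elim
    · rintro rfl
      exact ⟨i, rfl, rfl⟩
  simp only [Instance.look, SoloState.look, hset, h.info_eq, h.board]

theorem step_pos_of_eq_bh (h : s.pos i = I.bh) : (I.step A t s).pos i = I.bh := by
  simp [Instance.step, Instance.Active, h]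

/-- A lonely agent which tries to use an edge that is present traverses it. -/
theorem IsSolo.step_pos_of_adj (h : I.IsSolo s i σ) {p : ℕ} (hp : p < I.deg (s.pos i))
    (ha : σ.attempt A (I.id i) (I.deg (s.pos i)) = some p)
    (hadj : (I.snapshot t).Adj (s.pos i) (I.port (s.pos i) ⟨p, hp⟩).1) :
    (I.step A t s).pos i = (I.port (s.pos i) ⟨p, hp⟩).1 := by
  unfold SoloState.attempt at ha
  split_ifs at ha with ho
  have hact : I.Active s i := ⟨h.safe, h.output.trans ho⟩
  split at ha
  · rename_i q hq
    split_ifs at ha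
    obtain rfl : q = p := by simpa using ha
    simp only [Instance.step, if_pos hact, h.look_eq, hq, Instance.moveResult, dif_pos hp,
      if_pos hadj]
  · simp at ha

/-- A lonely agent which does not try to use an edge that is present stays where it is. -/
theorem IsSolo.step_pos_of_not_adj (h : I.IsSolo s i σ)
    (hb : ∀ p (hp : p < I.deg (s.pos i)), σ.attempt A (I.id i) (I.deg (s.pos i)) = some p →
      ¬ (I.snapshot t).Adj (s.pos i) (I.port (s.pos i) ⟨p, hp⟩).1) :
    (I.step A t s).pos i = s.pos i := by
  by_cases ho : σ.output = none
  · have hact : I.Active s i := ⟨h.safe, h.output.trans ho⟩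
    simp only [Instance.step, if_pos hact, h.look_eq]
    simp only [SoloState.attempt, if_pos ho] at hb
    rcases hd : (A (σ.look (I.id i) (I.deg (s.pos i)))).action with _ | p | ⟨w, p⟩
    · simp [Instance.moveResult]
    · by_cases hp : p < I.deg (s.pos i)
      · have := hb p hp (by simp [hd, hp])
        simp only [Instance.moveResult, dif_pos hp, if_neg this]
      · simp [Instance.moveResult, hp]
    · simp [Instance.moveResult]
  · have hact : ¬ I.Active s i := fun hh => ho (h.output.symm.trans hh.2)
    simp only [Instance.step, if_neg hact]

-- The invariance step for solitude. No other agent is at the node, so nobody else can write on its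
-- whiteboard; `halone` is needed because another agent could arrive during the round.
open scoped Classical in
theorem IsSolo.step_of_not_adj (h : I.IsSolo s i σ)
    (hb : ∀ p (hp : p < I.deg (s.pos i)), σ.attempt A (I.id i) (I.deg (s.pos i)) = some p →
      ¬ (I.snapshot t).Adj (s.pos i) (I.port (s.pos i) ⟨p, hp⟩).1)
    (halone : ∀ j, j ≠ i → (I.step A t s).pos j ≠ s.pos i) :
    I.IsSolo (I.step A t s) i (σ.step A (I.id i) (I.deg (s.pos i))) := by
  have hpos := h.step_pos_of_not_adj hb
  have hboard : (I.step A t s).board (s.pos i) =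
      (if I.Active s i then (A (I.look s i)).write else none).getD (s.board (s.pos i)) := by
    simp only [Instance.step]
    rw [findSome?_eq_of_unique (List.mem_finRange i)]
    · simp
    · intro j hj
      exact if_neg fun hh => h.alone j hj hh.2
  by_cases ho : σ.output = none
  · have hact : I.Active s i := ⟨h.safe, h.output.trans ho⟩
    refine ⟨hpos ▸ h.safe, fun j hj => hpos ▸ halone j hj, ?_, ?_, ?_, ?_⟩
    · simp only [Instance.step, if_pos hact, h.look_eq, SoloState.step, if_pos ho]
    · simp only [Instance.step, if_pos hact, h.look_eq, SoloState.step, if_pos ho]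
      simp only [SoloState.attempt, if_pos ho] at hb
      rcases hd : (A (σ.look (I.id i) (I.deg (s.pos i)))).action with _ | p | ⟨w, p⟩
      · simp [Instance.moveResult]
      · by_cases hp : p < I.deg (s.pos i)
        · have := hb p hp (by simp [hd, hp])
          simp only [Instance.moveResult, dif_pos hp, if_neg this, if_pos hp]
        · simp [Instance.moveResult, hp]
      · simp [Instance.moveResult]
    · simp only [Instance.step, if_pos hact, h.look_eq, SoloState.step, if_pos ho]
    · rw [hpos, hboard]
      simp only [if_pos hact, h.look_eq, SoloState.step, if_pos ho, h.board]
  · have hact : ¬ I.Active s i := fun hh => ho (h.output.symm.trans hh.2)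
    rw [if_neg hact] at hboard
    refine ⟨hpos ▸ h.safe, fun j hj => hpos ▸ halone j hj, ?_, ?_, ?_, ?_⟩
    · simp only [Instance.step, if_neg hact, SoloState.step, if_neg ho, h.mem]
    · simp only [Instance.step, if_neg hact, SoloState.step, if_neg ho, h.feedback]
    · simp only [Instance.step, if_neg hact, SoloState.step, if_neg ho, h.output]
    · rw [hpos, hboard]
      simp only [SoloState.step, if_neg ho, h.board, Option.getD_none]

theorem adj_of_nbr {u v : Fin n} {p : ℕ} (h : I.nbr u p = some v) : I.G.Adj u v := by
  unfold Instance.nbr at h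
  split_ifs at h with hp
  rw [← Option.some.inj h]
  exact (I.port u ⟨p, hp⟩).2

end Instance

/-! ### The footprint, its leaves and its port numberings -/

/-- A 4-cycle `0, 1, 5, 2` with a leaf `3` at `1`, a leaf `4` at `2`, and all further nodes as leaves
at `5`. -/
def ringGraph (n : ℕ) : SimpleGraph (Fin n) :=
  SimpleGraph.fromRel fun u v =>
    (u.1 = 0 ∧ (v.1 = 1 ∨ v.1 = 2)) ∨ (v.1 = 5 ∧ (u.1 = 1 ∨ u.1 = 2 ∨ 6 ≤ u.1)) ∨
      (u.1 = 1 ∧ v.1 = 3) ∨ (u.1 = 2 ∧ v.1 = 4)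

theorem ringGraph_adj {n : ℕ} {u v : Fin n} : (ringGraph n).Adj u v ↔
    ((u.1 = 0 ∧ (v.1 = 1 ∨ v.1 = 2)) ∨ (v.1 = 5 ∧ (u.1 = 1 ∨ u.1 = 2 ∨ 6 ≤ u.1)) ∨
      (u.1 = 1 ∧ v.1 = 3) ∨ (u.1 = 2 ∧ v.1 = 4)) ∨
    ((v.1 = 0 ∧ (u.1 = 1 ∨ u.1 = 2)) ∨ (u.1 = 5 ∧ (v.1 = 1 ∨ v.1 = 2 ∨ 6 ≤ v.1)) ∨
      (v.1 = 1 ∧ u.1 = 3) ∨ (v.1 = 2 ∧ u.1 = 4)) := by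
  rw [ringGraph, SimpleGraph.fromRel_adj, and_iff_right_iff_imp]
  intro h huv
  rw [huv] at h
  omega

theorem ringGraph_deleteEdges_adj {n : ℕ} {a x u v : Fin n} :
    ((ringGraph n).deleteEdges {s(a, x)}).Adj u v ↔
      (ringGraph n).Adj u v ∧ ¬ ((u = a ∧ v = x) ∨ (u = x ∧ v = a)) := by
  simp [SimpleGraph.deleteEdges_adj]

/-- The removed edge lies on the 4-cycle, so node 0 still reaches 5 the other way round; all other
nodes reach 5 without using node 0. -/
theorem ringGraph_deleteEdges_connected {n : ℕ} (hn : 7 ≤ n) {a x : Fin n} (ha : a.1 = 0)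
    (hx : x.1 = 1 ∨ x.1 = 2) : ((ringGraph n).deleteEdges {s(a, x)}).Connected := by
  have adj : ∀ u v : Fin n, (ringGraph n).Adj u v → u.1 ≠ 0 ∨ v.1 ≠ x.1 → u.1 ≠ x.1 ∨ v.1 ≠ 0 →
      ((ringGraph n).deleteEdges {s(a, x)}).Reachable u v := by
    intro u v h h1 h2
    refine SimpleGraph.Adj.reachable (ringGraph_deleteEdges_adj.2 ⟨h, ?_⟩)
    simp only [Fin.ext_iff]
    omega
  have h1 : ((ringGraph n).deleteEdges {s(a, x)}).Reachable ⟨1, by omega⟩ ⟨5, by omega⟩ :=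
    adj _ _ (ringGraph_adj.2 (by simp)) (by simp) (by simp)
  have h2 : ((ringGraph n).deleteEdges {s(a, x)}).Reachable ⟨2, by omega⟩ ⟨5, by omega⟩ :=
    adj _ _ (ringGraph_adj.2 (by simp)) (by simp) (by simp)
  have key : ∀ v : Fin n,
      ((ringGraph n).deleteEdges {s(a, x)}).Reachable v ⟨5, by omega⟩ := by
    rintro ⟨v, hv⟩
    rcases (by omega : v = 0 ∨ v = 1 ∨ v = 2 ∨ v = 3 ∨ v = 4 ∨ v = 5 ∨ 6 ≤ v) with
      rfl | rfl | rfl | rfl | rfl | rfl | h6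
    · rcases hx with hx | hx
      · exact (adj _ ⟨2, by omega⟩ (ringGraph_adj.2 (by simp)) (by simp [hx]) (by simp [hx])).trans
          h2
      · exact (adj _ ⟨1, by omega⟩ (ringGraph_adj.2 (by simp)) (by simp [hx]) (by simp [hx])).trans
          h1
    · exact h1
    · exact h2
    · exact (adj _ ⟨1, by omega⟩ (ringGraph_adj.2 (by simp)) (by simp) (by simp)).trans h1
    · exact (adj _ ⟨2, by omega⟩ (ringGraph_adj.2 (by simp)) (by simp) (by simp)).trans h2
    · exact SimpleGraph.Reachable.refl _
    · exact adj _ _ (ringGraph_adj.2 (by simp [h6])) (by simp; omega) (by simp)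
  have : Nonempty (Fin n) := ⟨a⟩
  exact ⟨fun u v => (key u).trans (key v).symm⟩

theorem ringGraph_neighborSet_one {n : ℕ} (hn : 7 ≤ n) :
    (ringGraph n).neighborSet ⟨1, by omega⟩ = {⟨0, by omega⟩, ⟨3, by omega⟩, ⟨5, by omega⟩} := by
  ext v
  simp only [SimpleGraph.mem_neighborSet, ringGraph_adj, Set.mem_insert_iff,
    Set.mem_singleton_iff, Fin.ext_iff]
  grind

theorem ringGraph_neighborSet_two {n : ℕ} (hn : 7 ≤ n) :
    (ringGraph n).neighborSet ⟨2, by omega⟩ = {⟨0, by omega⟩, ⟨4, by omega⟩, ⟨5, by omega⟩} := by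
  ext v
  simp only [SimpleGraph.mem_neighborSet, ringGraph_adj, Set.mem_insert_iff,
    Set.mem_singleton_iff, Fin.ext_iff]
  grind

theorem card_ringGraph_neighborSet_one {n : ℕ} (hn : 7 ≤ n) :
    Nat.card ((ringGraph n).neighborSet ⟨1, by omega⟩) = 3 := by
  rw [Nat.card_coe_set_eq, ringGraph_neighborSet_one hn, Set.ncard_eq_three]
  exact ⟨_, _, _, by simp, by simp, by simp, rfl⟩

theorem card_ringGraph_neighborSet_two {n : ℕ} (hn : 7 ≤ n) :
    Nat.card ((ringGraph n).neighborSet ⟨2, by omega⟩) = 3 := by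
  rw [Nat.card_coe_set_eq, ringGraph_neighborSet_two hn, Set.ncard_eq_three]
  exact ⟨_, _, _, by simp, by simp, by simp, rfl⟩

theorem card_ringGraph_neighborSet_leaf {n : ℕ} {v : Fin n}
    (hn : 7 ≤ n) (hv : v.1 = 3 ∨ v.1 = 4 ∨ v.1 = 6) :
    Nat.card ((ringGraph n).neighborSet v) = 1 := by
  rw [Nat.card_coe_set_eq, Set.ncard_eq_one]
  rcases hv with hv | hv | hv
  on_goal 1 => refine ⟨⟨1, by omega⟩, ?_⟩
  on_goal 2 => refine ⟨⟨2, by omega⟩, ?_⟩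
  on_goal 3 => refine ⟨⟨5, by omega⟩, ?_⟩
  all_goals
    ext u
    simp only [SimpleGraph.mem_neighborSet, ringGraph_adj, Set.mem_singleton_iff, Fin.ext_iff]
    omega

/-- There is a port numbering of `ringGraph n` such that the leaves at `1` and at `2` are reached
through the same prescribed port. -/
theorem exists_ringGraph_port {n : ℕ} (hn : 7 ≤ n) (p : ℕ) :
    ∃ port : ∀ v : Fin n, Fin (Nat.card ((ringGraph n).neighborSet v)) ≃
        (ringGraph n).neighborSet v,
      (∀ h : p < Nat.card ((ringGraph n).neighborSet ⟨1, by omega⟩),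
        (port ⟨1, by omega⟩ ⟨p, h⟩).1 = ⟨3, by omega⟩) ∧
      ∀ h : p < Nat.card ((ringGraph n).neighborSet ⟨2, by omega⟩),
        (port ⟨2, by omega⟩ ⟨p, h⟩).1 = ⟨4, by omega⟩ := by
  classical
  have key : ∀ v : Fin n, ∃ e : Fin (Nat.card ((ringGraph n).neighborSet v)) ≃
      (ringGraph n).neighborSet v, ∀ h w, (ringGraph n).Adj v w → (v.1 = 1 ∨ v.1 = 2) →
        w.1 = v.1 + 2 → (e ⟨p, h⟩).1 = w := by
    intro v
    let e := (Finite.equivFin ((ringGraph n).neighborSet v)).symm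
    by_cases hw : ∃ w, (ringGraph n).Adj v w ∧ w.1 = v.1 + 2
    · obtain ⟨w, hvw, hw⟩ := hw
      by_cases h : p < Nat.card ((ringGraph n).neighborSet v)
      -- Any numbering, corrected by one transposition, gives port `p` to the prescribed neighbour;
      -- `v + 2` names the leaf at both 1 and 2.
      · refine ⟨e.trans (Equiv.swap (e ⟨p, h⟩) ⟨w, hvw⟩), fun h w' _ _ hw' => ?_⟩
        rw [Equiv.trans_apply, Equiv.swap_apply_left]
        exact Fin.ext (hw.trans hw'.symm)
      · exact ⟨e, fun h' => (h h').elim⟩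
    · exact ⟨e, fun _ w hvw _ hw' => (hw ⟨w, hvw, hw'⟩).elim⟩
  choose port hport using key
  refine ⟨port, fun h => hport _ h _ ?_ ?_ ?_, fun h => hport _ h _ ?_ ?_ ?_⟩ <;>
    simp [ringGraph_adj]

/-! ### The two-agent instances and their executions -/

/-- The instance on `ringGraph n` with an agent at node `0` and an agent at node `b`, in which the edge
between `0` and `x t` is removed in round `t`. -/
def ringInstance {n : ℕ} (hn : 7 ≤ n) {c : ℝ} (hc : 1 < c)
    (port : ∀ v : Fin n, Fin (Nat.card ((ringGraph n).neighborSet v)) ≃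
      (ringGraph n).neighborSet v)
    (x : ℕ → Fin n) (hx : ∀ t, (x t).1 = 1 ∨ (x t).1 = 2)
    (b bh : Fin n) (hbh : bh.1 ≠ 0) (hb : b ≠ bh) : Instance n 1 c where
  G := ringGraph n
  port := port
  snapshot t := (ringGraph n).deleteEdges {s(⟨0, by omega⟩, x t)}
  snapshot_le _ := SimpleGraph.deleteEdges_le _
  snapshot_connected t := ringGraph_deleteEdges_connected hn rfl (hx t)
  removed_le t := by
    rw [SimpleGraph.edgeSet_deleteEdges, sdiff_sdiff_right_self]
    exact (Set.ncard_le_ncard Set.inter_subset_right (Set.finite_singleton _)).trans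
      (Set.ncard_singleton _).le
  bh := bh
  k := 2
  id i := i.1 + 1
  id_strictMono i j h := by
    have : i.1 < j.1 := h
    simpa using this
  one_le_id i := by omega
  id_le i := by
    have h1 : (1 : ℝ) ≤ n := by exact_mod_cast (by omega : 1 ≤ n)
    have h2 : ((i.1 + 1 : ℕ) : ℝ) ≤ n := by
      have := i.2
      exact_mod_cast (by omega : i.1 + 1 ≤ n)
    calc ((i.1 + 1 : ℕ) : ℝ) ≤ (n : ℝ) ^ (1 : ℝ) := by rwa [Real.rpow_one]
      _ ≤ (n : ℝ) ^ c := Real.rpow_le_rpow_of_exponent_le h1 hc.le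
  start := ![⟨0, by omega⟩, b]
  start_safe i := by
    fin_cases i
    · intro h
      exact hbh (congrArg Fin.val h).symm
    · exact hb

namespace Instance

variable {n : ℕ} {c : ℝ}

/-- The designated edge does not depend on the black hole, and is incident to at most one of any
two nonadjacent nodes. -/
theorem not_designatesBH_or {f : ℕ} {I J : Instance n f c} (hfollow : ∀ v w, J.follow v w = I.follow v w) (hnbr : ∀ v p, J.nbr v p = I.nbr v p)
    (hne : I.bh ≠ J.bh) (hadj : ¬ I.G.Adj I.bh J.bh) (v : Fin n) (w : List ℕ) (p : ℕ) :
    ¬ I.DesignatesBH v w p ∨ ¬ J.DesignatesBH v w p := by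
  by_contra h
  push Not at h
  obtain ⟨⟨u, u', h1, h2, h3⟩, ⟨z, z', k1, k2, k3⟩⟩ := h
  rw [hfollow, h1] at k1
  obtain rfl := Option.some.inj k1
  rw [hnbr, h2] at k2
  obtain rfl := Option.some.inj k2
  have huu := adj_of_nbr h2
  rcases h3 with h3 | h3 <;> rcases k3 with k3 | k3
  · exact hne (h3.symm.trans k3)
  · exact hadj (h3 ▸ k3 ▸ huu)
  · exact hadj (h3 ▸ k3 ▸ huu.symm)
  · exact hne (h3.symm.trans k3)

end Instance

section Ring

variable {n : ℕ} {hn : 7 ≤ n} {c : ℝ} {hc : 1 < c}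
  {port : ∀ v : Fin n, Fin (Nat.card ((ringGraph n).neighborSet v)) ≃ (ringGraph n).neighborSet v}
  {x : ℕ → Fin n} {hx : ∀ t, (x t).1 = 1 ∨ (x t).1 = 2}
  {b bh b' bh' : Fin n} {hbh : bh.1 ≠ 0} {hb : b ≠ bh} {hbh' : bh'.1 ≠ 0} {hb' : b' ≠ bh'}

/-- The leaves 3, 4, 6 are pairwise nonadjacent, and following ports involves neither the black hole
nor the starting nodes. -/
theorem ringInstance_not_designatesBH_or (h3 : bh.1 = 3 ∨ bh.1 = 4 ∨ bh.1 = 6)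
    (h3' : bh'.1 = 3 ∨ bh'.1 = 4 ∨ bh'.1 = 6) (hne : bh ≠ bh') (v : Fin n) (w : List ℕ) (p : ℕ) :
    ¬ (ringInstance hn hc port x hx b bh hbh hb).DesignatesBH v w p ∨
      ¬ (ringInstance hn hc port x hx b' bh' hbh' hb').DesignatesBH v w p := by
  refine Instance.not_designatesBH_or (I := ringInstance hn hc port x hx b bh hbh hb)
    (J := ringInstance hn hc port x hx b' bh' hbh' hb') (fun v w => ?_) (fun _ _ => rfl) hne
    (fun h => ?_) v w p
  · induction w generalizing v with
    | nil => rfl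
    | cons p w ih =>
      simp only [Instance.follow, ih]
      rfl
  · have := ringGraph_adj.1 (show (ringGraph n).Adj bh bh' from h)
    omega

/-- In `ringInstance`, if the adversary always blocks the agent at `0`, and the first move of the agent
at `b` leads to the black hole, then the agent at `0` stays there forever, and the agent at `b`
stays there until it is destroyed. -/
theorem ringInstance_exec (A : Algorithm) (hb0 : b.1 ≠ 0)
    (hx0 : ∀ t p (h : p < Nat.card ((ringGraph n).neighborSet ⟨0, by omega⟩)),
      (solo A 1 (Nat.card ((ringGraph n).neighborSet ⟨0, by omega⟩)) t).attempt A 1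
        (Nat.card ((ringGraph n).neighborSet ⟨0, by omega⟩)) = some p →
      (port ⟨0, by omega⟩ ⟨p, h⟩).1 = x t)
    {d : ℕ} (hd : Nat.card ((ringGraph n).neighborSet b) = d)
    (hp : ∀ t p (h : p < Nat.card ((ringGraph n).neighborSet b)),
      (solo A 2 d t).attempt A 2 d = some p →
      (∀ s < t, (solo A 2 d s).attempt A 2 d = none) →
      (port b ⟨p, h⟩).1 = bh) (t : ℕ) :
    letI I := ringInstance hn hc port x hx b bh hbh hb
    letI i₀ : Fin I.k := (0 : Fin 2)
    letI i₁ : Fin I.k := (1 : Fin 2)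
    (I.exec A t).pos i₀ = ⟨0, by omega⟩ ∧
      I.IsSolo (I.exec A t) i₀
        (solo A 1 (Nat.card ((ringGraph n).neighborSet ⟨0, by omega⟩)) t) ∧
      ((I.exec A t).pos i₁ = bh ∨ (I.exec A t).pos i₁ = b ∧
        I.IsSolo (I.exec A t) i₁ (solo A 2 d t) ∧
        ∀ s < t, (solo A 2 d s).attempt A 2 d = none) := by
  -- Keeping `d` apart from the degree lets the literal `3` serve for both starting nodes 1 and 2,
  -- with one and the same solo run.
  subst hd
  let I := ringInstance hn hc port x hx b bh hbh hb
  let i₀ : Fin I.k := (0 : Fin 2)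
  let i₁ : Fin I.k := (1 : Fin 2)
  let a : Fin n := ⟨0, by omega⟩
  have hab : b ≠ a := fun h => hb0 (congrArg Fin.val h)
  have habh : bh ≠ a := fun h => hbh (congrArg Fin.val h)
  have eq1 : ∀ j : Fin I.k, j ≠ i₀ → j = i₁ := by
    intro (j : Fin 2) (hj : j ≠ 0)
    change j = 1
    omega
  have eq0 : ∀ j : Fin I.k, j ≠ i₁ → j = i₀ := by
    intro (j : Fin 2) (hj : j ≠ 1)
    change j = 0
    omega
  induction t with
  | zero =>
    refine ⟨rfl, ⟨habh.symm, fun j hj => ?_, rfl, rfl, rfl, rfl⟩,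
      Or.inr ⟨rfl, ⟨hb, fun j hj => ?_, rfl, rfl, rfl, rfl⟩, by simp⟩⟩
    · rw [eq1 j hj]
      exact hab
    · rw [eq0 j hj]
      exact hab.symm
  | succ t ih =>
    obtain ⟨h0, hs0, h1⟩ := ih
    change (I.exec A t).pos i₀ = a at h0
    change I.IsSolo (I.exec A t) i₀ _ at hs0
    have hblock : ∀ p (hp : p < I.deg ((I.exec A t).pos i₀)),
        (solo A 1 (Nat.card ((ringGraph n).neighborSet a)) t).attempt A (I.id i₀)
          (I.deg ((I.exec A t).pos i₀)) = some p →
        ¬ (I.snapshot t).Adj ((I.exec A t).pos i₀)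
          (I.port ((I.exec A t).pos i₀) ⟨p, hp⟩).1 := by
      rw [h0]
      intro p hp ha hadj
      have := hx0 t p hp ha
      change ((ringGraph n).deleteEdges {s(a, x t)}).Adj a (port a ⟨p, hp⟩).1 at hadj
      rw [this] at hadj
      exact (ringGraph_deleteEdges_adj.1 hadj).2 (Or.inl ⟨rfl, rfl⟩)
    -- Both new positions are settled before solitude is propagated, since solitude requires that
    -- the other agent does not arrive.
    have h0' : (I.exec A (t + 1)).pos i₀ = a := (hs0.step_pos_of_not_adj hblock).trans h0
    have h1' : (I.exec A (t + 1)).pos i₁ = bh ∨ (I.exec A (t + 1)).pos i₁ = b ∧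
        I.IsSolo (I.exec A (t + 1)) i₁
          (solo A 2 (Nat.card ((ringGraph n).neighborSet b)) (t + 1)) ∧
        ∀ s < t + 1, (solo A 2 (Nat.card ((ringGraph n).neighborSet b)) s).attempt A 2
          (Nat.card ((ringGraph n).neighborSet b)) = none := by
      rcases h1 with h1 | ⟨h1, hs1, hno⟩
      · exact Or.inl (Instance.step_pos_of_eq_bh h1)
      · change (I.exec A t).pos i₁ = b at h1
        change I.IsSolo (I.exec A t) i₁ _ at hs1
        rcases hat : (solo A 2 (Nat.card ((ringGraph n).neighborSet b)) t).attempt A 2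
          (Nat.card ((ringGraph n).neighborSet b)) with _ | p
        · right
          have hstay : ∀ p (hp : p < I.deg ((I.exec A t).pos i₁)),
              (solo A 2 (Nat.card ((ringGraph n).neighborSet b)) t).attempt A (I.id i₁)
                (I.deg ((I.exec A t).pos i₁)) = some p →
              ¬ (I.snapshot t).Adj ((I.exec A t).pos i₁)
                (I.port ((I.exec A t).pos i₁) ⟨p, hp⟩).1 := by
            rw [h1]
            intro p _ ha
            exact absurd (hat.symm.trans ha) (by simp)
          refine ⟨(hs1.step_pos_of_not_adj hstay).trans h1, ?_, ?_⟩
          · have := hs1.step_of_not_adj hstay (fun j hj => by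
              rw [eq0 j hj, h1]
              exact fun h => hab (h.symm.trans h0'))
            rw [h1] at this
            exact this
          · intro s hs
            rcases Nat.lt_succ_iff_lt_or_eq.1 hs with hs | rfl
            · exact hno s hs
            · exact hat
        · left
          have hlt := SoloState.lt_of_attempt hat
          have hport := hp t p hlt hat hno
          have hlt' : p < I.deg ((I.exec A t).pos i₁) := by rw [h1]; exact hlt
          have hpe : (I.port ((I.exec A t).pos i₁) ⟨p, hlt'⟩).1 = bh := by
            have : ∀ v (hv : v = b) (h : p < I.deg v), (I.port v ⟨p, h⟩).1 = bh := by
              rintro v rfl h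
              exact hport
            exact this _ h1 hlt'
          refine (hs1.step_pos_of_adj (A := A) (t := t) hlt' ?_ ?_).trans hpe
          · rw [h1]
            exact hat
          · rw [hpe, h1]
            -- The removed edge contains node 0, while neither `b` nor `bh` is 0, so the way into
            -- the black hole is open.
            refine ringGraph_deleteEdges_adj.2 ⟨?_, ?_⟩
            · rw [← hport]
              exact (port b ⟨p, hlt⟩).2
            · rintro (⟨h, -⟩ | ⟨-, h⟩)
              · exact hab h
              · exact habh h
    refine ⟨h0', ?_, h1'⟩
    have := hs0.step_of_not_adj hblock (fun j hj => by
      rw [eq1 j hj, h0]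
      rcases h1' with h | ⟨h, -⟩
      · exact fun h' => habh (h.symm.trans h')
      · exact fun h' => hab (h.symm.trans h'))
    rw [h0] at this
    exact this

theorem ringInstance_not_foundBy (A : Algorithm) (hb0 : b.1 ≠ 0)
    (hx0 : ∀ t p (h : p < Nat.card ((ringGraph n).neighborSet ⟨0, by omega⟩)),
      (solo A 1 (Nat.card ((ringGraph n).neighborSet ⟨0, by omega⟩)) t).attempt A 1
        (Nat.card ((ringGraph n).neighborSet ⟨0, by omega⟩)) = some p →
      (port ⟨0, by omega⟩ ⟨p, h⟩).1 = x t)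
    {d : ℕ} (hd : Nat.card ((ringGraph n).neighborSet b) = d)
    (hp : ∀ t p (h : p < Nat.card ((ringGraph n).neighborSet b)),
      (solo A 2 d t).attempt A 2 d = some p →
      (∀ s < t, (solo A 2 d s).attempt A 2 d = none) → (port b ⟨p, h⟩).1 = bh)
    (h1 : ∀ t w p, (solo A 1 (Nat.card ((ringGraph n).neighborSet ⟨0, by omega⟩)) t).output =
      some (w, p) → ¬ (ringInstance hn hc port x hx b bh hbh hb).DesignatesBH ⟨0, by omega⟩ w p)
    (h2 : ∀ t w p, (solo A 2 d t).output = some (w, p) →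
      (∀ s < t, (solo A 2 d s).attempt A 2 d = none) →
      ¬ (ringInstance hn hc port x hx b bh hbh hb).DesignatesBH b w p) :
    ¬ (ringInstance hn hc port x hx b bh hbh hb).FoundBy A := by
  rintro ⟨t, (i : Fin 2), w, p, hsafe, hout, hdes⟩
  obtain ⟨hpos, hs0, hrest⟩ := ringInstance_exec (hc := hc) (hx := hx) (hbh := hbh) (hb := hb)
    A hb0 hx0 hd hp t
  fin_cases i
  · exact h1 t w p (hs0.output.symm.trans hout) (hpos ▸ hdes)
  · rcases hrest with hbh1 | ⟨hposb, hs1, hno⟩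
    · exact hsafe hbh1
    · refine h2 t w p (hs1.output.symm.trans hout) hno ?_
      have key : ∀ v, v = b →
          (ringInstance hn hc port x hx b bh hbh hb).DesignatesBH v w p →
          (ringInstance hn hc port x hx b bh hbh hb).DesignatesBH b w p := by
        intro v hv h
        rwa [hv] at h
      exact key _ hposb hdes

end Ring

end BlackHole

/-! ### Choosing the instance that defeats the algorithm -/

open BlackHole in
theorem mainTheorem1 (c : ℝ) (hc : 1 < c) (A : BlackHole.Algorithm)
    (hA : BlackHole.UsesLogSpace A 1 c) :
    ∃ n₀ : ℕ, ∀ n : ℕ, n₀ ≤ n → ∃ I : BlackHole.Instance n 1 c,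
      I.k = 2 * I.deg I.bh ∧ ¬ I.FoundBy A := by
  -- Seven nodes are just enough for the third candidate leaf, node 6.
  refine ⟨7, fun n hn => ?_⟩
  let d₀ := Nat.card ((ringGraph n).neighborSet ⟨0, by omega⟩)
  obtain ⟨⟨w₁, p₁⟩, ho₁⟩ := exists_solo_output A 1 d₀
  obtain ⟨⟨w₂, p₂⟩, ho₂⟩ := exists_solo_output A 2 3
  have hcard1 := card_ringGraph_neighborSet_one hn
  have hcard2 := card_ringGraph_neighborSet_two hn
  have hx : ∀ port : ∀ v : Fin n, Fin (Nat.card ((ringGraph n).neighborSet v)) ≃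
      (ringGraph n).neighborSet v, ∃ x : ℕ → Fin n, (∀ t, (x t).1 = 1 ∨ (x t).1 = 2) ∧
        ∀ t p (h : p < d₀), (solo A 1 d₀ t).attempt A 1 d₀ = some p →
          (port ⟨0, by omega⟩ ⟨p, h⟩).1 = x t := by
    intro port
    have key : ∀ t, ∃ y : Fin n, (y.1 = 1 ∨ y.1 = 2) ∧ ∀ p (h : p < d₀),
        (solo A 1 d₀ t).attempt A 1 d₀ = some p → (port ⟨0, by omega⟩ ⟨p, h⟩).1 = y := by
      intro t
      rcases hat : (solo A 1 d₀ t).attempt A 1 d₀ with _ | p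
      -- Without an attempt, which edge at 0 is removed is irrelevant.
      · exact ⟨⟨1, by omega⟩, Or.inl rfl, by simp⟩
      · have hp := SoloState.lt_of_attempt hat
        refine ⟨(port ⟨0, by omega⟩ ⟨p, hp⟩).1, ?_, ?_⟩
        · have := ringGraph_adj.1 (port ⟨0, by omega⟩ ⟨p, hp⟩).2
          simp only at this
          omega
        · intro q hq hpq
          obtain rfl := Option.some.inj hpq
          rfl
    choose x hx using key
    exact ⟨x, fun t => (hx t).1, fun t => (hx t).2⟩
  have h34 : (⟨3, by omega⟩ : Fin n) ≠ ⟨4, by omega⟩ := by simp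
  have h36 : (⟨3, by omega⟩ : Fin n) ≠ ⟨6, by omega⟩ := by simp
  have h46 : (⟨4, by omega⟩ : Fin n) ≠ ⟨6, by omega⟩ := by simp
  have leaf := fun (v : Fin n) hv => card_ringGraph_neighborSet_leaf (v := v) hn hv
  -- Only the solo run decides this, so the numbering of the ports can still depend on the answer.
  by_cases hmove : ∃ t p, (solo A 2 3 t).attempt A 2 3 = some p ∧
      ∀ s < t, (solo A 2 3 s).attempt A 2 3 = none
  · obtain ⟨T, q, hq, hqmin⟩ := hmove
    obtain ⟨port, hport1, hport2⟩ := exists_ringGraph_port hn q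
    obtain ⟨x, hx, hx0⟩ := hx port
    have hfirst : ∀ t p, (solo A 2 3 t).attempt A 2 3 = some p →
        (∀ s < t, (solo A 2 3 s).attempt A 2 3 = none) → p = q := by
      intro t p hp hmin
      rcases lt_trichotomy t T with h | rfl | h
      · simp [hqmin t h] at hp
      · exact Option.some.inj (hp.symm.trans hq)
      · simp [hmin T h] at hq
    have hout : ∀ t w p, (solo A 2 3 t).output = some (w, p) →
        ¬ ∀ s < t, (solo A 2 3 s).attempt A 2 3 = none := by
      intro t w p ho hmin
      rcases lt_or_ge T t with h | h
      · simp [hmin T h] at hq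
      · simp [solo_attempt_of_output h ho] at hq
    -- Both instances share `port` and `x`, hence also the run of the agent at 0; its designation
    -- misses one of the two black holes.
    rcases ringInstance_not_designatesBH_or (hn := hn) (hc := hc) (port := port) (x := x) (hx := hx)
      (b := ⟨1, by omega⟩) (bh := ⟨3, by omega⟩) (b' := ⟨2, by omega⟩) (bh' := ⟨4, by omega⟩)
      (hbh := by simp) (hbh' := by simp) (hb := by simp) (hb' := by simp)
      (by simp) (by simp) h34 ⟨0, by omega⟩ w₁ p₁ with hd | hd
    · refine ⟨ringInstance hn hc port x hx ⟨1, by omega⟩ ⟨3, by omega⟩ (by simp) (by simp),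
        (congrArg (2 * ·) (leaf ⟨3, by omega⟩ (by simp))).symm,
        ringInstance_not_foundBy A (by simp) hx0 hcard1 ?_ ?_ ?_⟩
      · intro t p h hp hmin
        obtain rfl := hfirst t p hp hmin
        exact hport1 h
      · intro t w p ho
        obtain ⟨rfl, rfl⟩ := Prod.ext_iff.1 (ho₁ t _ ho)
        exact hd
      · intro t w p ho hmin
        exact (hout t w p ho hmin).elim
    · refine ⟨ringInstance hn hc port x hx ⟨2, by omega⟩ ⟨4, by omega⟩ (by simp) (by simp),
        (congrArg (2 * ·) (leaf ⟨4, by omega⟩ (by simp))).symm,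
        ringInstance_not_foundBy A (by simp) hx0 hcard2 ?_ ?_ ?_⟩
      · intro t p h hp hmin
        obtain rfl := hfirst t p hp hmin
        exact hport2 h
      · intro t w p ho
        obtain ⟨rfl, rfl⟩ := Prod.ext_iff.1 (ho₁ t _ ho)
        exact hd
      · intro t w p ho hmin
        exact (hout t w p ho hmin).elim
  · obtain ⟨port, -⟩ := exists_ringGraph_port hn 0
    obtain ⟨x, hx, hx0⟩ := hx port
    have finish : ∀ (bh : Fin n) (hl : bh.1 = 3 ∨ bh.1 = 4 ∨ bh.1 = 6) (hbh : bh.1 ≠ 0)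
        (hb : (⟨1, by omega⟩ : Fin n) ≠ bh),
        ¬ (ringInstance hn hc port x hx ⟨1, by omega⟩ bh hbh hb).DesignatesBH
          ⟨0, by omega⟩ w₁ p₁ →
        ¬ (ringInstance hn hc port x hx ⟨1, by omega⟩ bh hbh hb).DesignatesBH
          ⟨1, by omega⟩ w₂ p₂ →
        ∃ I : BlackHole.Instance n 1 c, I.k = 2 * I.deg I.bh ∧ ¬ I.FoundBy A := by
      intro bh hl hbh hb hd1 hd2
      refine ⟨ringInstance hn hc port x hx ⟨1, by omega⟩ bh hbh hb,
        (congrArg (2 * ·) (leaf _ hl)).symm,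
        ringInstance_not_foundBy A (by simp) hx0 hcard1 ?_ ?_ ?_⟩
      · intro t p h hp hmin
        exact (hmove ⟨t, p, hp, hmin⟩).elim
      · intro t w p ho
        obtain ⟨rfl, rfl⟩ := Prod.ext_iff.1 (ho₁ t _ ho)
        exact hd1
      · intro t w p ho _
        obtain ⟨rfl, rfl⟩ := Prod.ext_iff.1 (ho₂ t _ ho)
        exact hd2
    have avoid : ∀ (bh bh' : Fin n) (hl : bh.1 = 3 ∨ bh.1 = 4 ∨ bh.1 = 6)
        (hl' : bh'.1 = 3 ∨ bh'.1 = 4 ∨ bh'.1 = 6) (hbh : bh.1 ≠ 0) (hbh' : bh'.1 ≠ 0)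
        (hb : (⟨1, by omega⟩ : Fin n) ≠ bh) (hb' : (⟨1, by omega⟩ : Fin n) ≠ bh') (hne : bh ≠ bh')
        v w p,
        ¬ (ringInstance hn hc port x hx ⟨1, by omega⟩ bh hbh hb).DesignatesBH v w p ∨
        ¬ (ringInstance hn hc port x hx ⟨1, by omega⟩ bh' hbh' hb').DesignatesBH v w p :=
      fun bh bh' hl hl' _ _ _ _ hne => ringInstance_not_designatesBH_or hl hl' hne
    have f3 := finish ⟨3, by omega⟩ (by simp) (by simp) (by simp)
    have f4 := finish ⟨4, by omega⟩ (by simp) (by simp) (by simp)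
    have f6 := finish ⟨6, by omega⟩ (by simp) (by simp) (by simp)
    have a34 := avoid ⟨3, by omega⟩ ⟨4, by omega⟩ (by simp) (by simp) (by simp) (by simp) (by simp)
      (by simp) h34
    have a36 := avoid ⟨3, by omega⟩ ⟨6, by omega⟩ (by simp) (by simp) (by simp) (by simp) (by simp)
      (by simp) h36
    have a46 := avoid ⟨4, by omega⟩ ⟨6, by omega⟩ (by simp) (by simp) (by simp) (by simp) (by simp)
      (by simp) h46
    -- Pigeonhole: each of the two designations rules out at most one of three leaves.
    rcases a34 ⟨0, by omega⟩ w₁ p₁ with h3 | h4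
    · rcases a34 ⟨1, by omega⟩ w₂ p₂ with k3 | k4
      · exact f3 h3 k3
      · rcases a46 ⟨0, by omega⟩ w₁ p₁ with h4 | h6
        · exact f4 h4 k4
        · rcases a36 ⟨1, by omega⟩ w₂ p₂ with k3 | k6
          · exact f3 h3 k3
          · exact f6 h6 k6
    · rcases a34 ⟨1, by omega⟩ w₂ p₂ with k3 | k4
      · rcases a36 ⟨0, by omega⟩ w₁ p₁ with h3 | h6
        · exact f3 h3 k3
        · rcases a46 ⟨1, by omega⟩ w₂ p₂ with k4 | k6
          · exact f4 h4 k4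
          · exact f6 h6 k6
      · exact f4 h4 k4
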